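/- Let $h:\mathbb{R}\times\mathbb{R}\to\mathbb{R}$ be $C^2$ with $h(x+1,x'+1)=h(x,x')$ and $h_{12}\le -c$ everywhere for some constant $c>0$ (subscripts denote partial derivatives). For a tilt $F$ put $h_F(x,x')=h(x,x')-Fx$ and consider the gradient flow $$\dot x_n=-h_2(x_{n-1},x_n)-h_1(x_n,x_{n+1})+F,\qquad n\in\mathbb{Z},$$ whose equilibria are the configurations $\mathbf{x}=(x_n)_{n\in\mathbb{Z}}$ with $h_2(x_{n-1},x_n)+h_1(x_n,x_{n+1})=F$ for all $n$. Order configurations pointwise ($\mathbf{x}<\mathbf{y}$ means $x_n\le y_n$ for all $n$ and $\mathbf{x}\ne\mathbf{y}$), and let $(T_{qp}\mathbf{x})_n=x_{n-q}+p$ for $p,q\in\mathbb{Z}$. A configuration is Birkhoff if the set of its translates $T_{qp}\mathbf{x}$ is totally ordered; it is of type $(p,q)$ if $T_{qp}\mathbf{x}=\mathbf{x}$; it has mean spacing $\omega$ if $(x_n-x_0)/n\to\omega$ as $n\to\pm\infty$. Let $\mathcal{X}$ be the space of configurations with norm $\sum_n 2^{-|n|}|x_n|<\infty$. Depinning force: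 for $\omega\in\mathbb{R}$ and $F\ge 0$, all (bounded-spacing) solutions starting at a configuration of width at most $1$ with $x_n-n\omega$ bounded have the same average velocity $$\bar\nu(\omega,F)=\lim_{m-k\to\infty,\;t\to+\infty}\frac1{t(m-k)}\int_0^t\sum_{n=k}^{m-1}\dot x_n(s)\,ds ,$$ where the width of $\mathbf{x}$ is $\sup_m\big(\min\{n: T_{mn}\mathbf{x}\ge\mathbf{x}\}-\max\{n: T_{mn}\mathbf{x}\le\mathbf{x}\}\big)$. Put $F_d(\omega)=\sup\{F\ge 0:\bar\nu(\omega,F)=0\}$ and $F_d(p/q+)=\limsup_{\omega\searrow p/q}F_d(\omega)$ (which is in fact a limit). An ordered circle is the image $\ell$ of a continuous $\tau:\mathbb{R}\to\mathcal{X}$ with $\tau(s_1)<\tau(s_2)$ for $s_1<s_2$ and $\tau(s+1)=\tau(s)+\mathbf{1}$. An invariant ordered circle (IOC) for $F$ is an ordered circle invariant under all translations $T_{qp}$ and under the gradient flow for all $t\in\mathbb{R}$. It is of type $p/q+$ if every $\mathbf{x}\in\ell$ has mean spacing $p/q$ and satisfies $T_{qp}\mathbf{x}\le\mathbf{x}$,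 and $T_{qp}\mathbf{x}\ne\mathbf{x}$ for some $\mathbf{x}\in\ell$. An equilibrium of type $p/q+$ is a Birkhoff equilibrium $\mathbf{x}$ for which there are Birkhoff equilibria $\mathbf{x}^-<\mathbf{x}<\mathbf{x}^+$ of type $(p,q)$ with $|x_n-x_n^-|\to0$ as $n\to-\infty$ and $|x_n-x_n^+|\to0$ as $n\to+\infty$. For an equilibrium $\mathbf{x}^*$ and integers $l<m-1$, let $$W^*_{l,m}(y_{l+1},\dots,y_{m-1})=h_F(x^*_l,y_{l+1})+\sum_{i=l+1}^{m-2}h_F(y_i,y_{i+1})+h_F(y_{m-1},x^*_m);$$ $\mathbf{x}^*$ has positive Morse index from $l$ to $m$ if the matrix $-D^2W^*_{l,m}$ at $(x^*_{l+1},\dots,x^*_{m-1})$ has at least one positive eigenvalue. **Theorem.** Let $p\in\mathbb{Z}$ and $q\ge1$ be coprime, let $F_d(p/q+)\le F<F_d(p/q)$, and let $\ell_F$ be an IOC of type $p/q+$ for $F$ such that every $\mathbf{z}\in\ell_F$ satisfies $\dot z_n=-h_2(z_{n-1},z_n)-h_1(z_n,z_{n+1})+F\ge0$ for all $n$. Then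 there are no equilibrium $\mathbf{x}^*\in\ell_F$ of type $p/q+$ and integers $l<m-1$ such that $\mathbf{x}^*$ has positive Morse index from $l$ to $m$. -/

import Mathlib

open Filter Topology

noncomputable section

namespace FK

/-! ### The energy and the gradient vector field -/

/-- `h₁`: partial derivative with respect to the first argument. -/
def d1 (h : ℝ → ℝ → ℝ) (x x' : ℝ) : ℝ := deriv (fun u => h u x') x

/-- `h₂`: partial derivative with respect to the second argument. -/
def d2 (h : ℝ → ℝ → ℝ) (x x' : ℝ) : ℝ := deriv (fun v => h x v) x'

/-- `h₁₂`: the mixed second partial derivative. -/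
def d12 (h : ℝ → ℝ → ℝ) (x x' : ℝ) : ℝ := deriv (fun v => d1 h x v) x'

/-- The standing assumptions on the nearest-neighbour energy `h`: it is `C²`, diagonally periodic,
and its mixed second derivative is bounded above by a negative constant. -/
structure IsEnergy (h : ℝ → ℝ → ℝ) : Prop where
  contDiff : ContDiff ℝ 2 (Function.uncurry h)
  periodic : ∀ x x', h (x + 1) (x' + 1) = h x x'
  twist : ∃ c : ℝ, 0 < c ∧ ∀ x x', d12 h x x' ≤ -c

/-- The tilted energy `h_F(x, x') = h(x, x') - F x`. -/
def tilted (h : ℝ → ℝ → ℝ) (F : ℝ) (x x' : ℝ) : ℝ := h x x' - F * x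

/-- The gradient vector field of the tilted chain:
`ẋ_n = -h₂(x_{n-1}, x_n) - h₁(x_n, x_{n+1}) + F`. -/
def vectorField (h : ℝ → ℝ → ℝ) (F : ℝ) (x : ℤ → ℝ) (n : ℤ) : ℝ :=
  -d2 h (x (n - 1)) (x n) - d1 h (x n) (x (n + 1)) + F

/-- Equilibria of the tilted chain. -/
def IsEquilibrium (h : ℝ → ℝ → ℝ) (F : ℝ) (x : ℤ → ℝ) : Prop :=
  ∀ n : ℤ, d2 h (x (n - 1)) (x n) + d1 h (x n) (x (n + 1)) = F

/-! ### Configurations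

Configurations are elements of `ℤ → ℝ`; the order on them is the pointwise partial order, and
`x < y` means `x ≤ y` and `x ≠ y`. -/

/-- The translation `(T_{qp} x)_n = x_{n-q} + p`. -/
def translate (q p : ℤ) (x : ℤ → ℝ) : ℤ → ℝ := fun n => x (n - q) + p

/-- Birkhoff configurations: the set of translates is totally ordered. -/
def IsBirkhoff (x : ℤ → ℝ) : Prop :=
  IsChain (· ≤ ·) {y : ℤ → ℝ | ∃ q p : ℤ, y = translate q p x}

/-- Configurations of type `(p, q)`. -/
def IsPeriodicType (p q : ℤ) (x : ℤ → ℝ) : Prop := translate q p x = x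

/-- Mean spacing: `ω = lim_{n → ±∞} (x_n - x_0) / n`. -/
def HasMeanSpacing (x : ℤ → ℝ) (ω : ℝ) : Prop :=
  Tendsto (fun n : ℤ => (x n - x 0) / (n : ℝ)) atTop (𝓝 ω) ∧
    Tendsto (fun n : ℤ => (x n - x 0) / (n : ℝ)) atBot (𝓝 ω)

/-- The terms of the weighted norm `‖x‖ = ∑ 2^{-|n|} |x_n|`. -/
def weightedTerm (x : ℤ → ℝ) (n : ℤ) : ℝ := (1 / 2 : ℝ) ^ n.natAbs * |x n|

/-- The weighted norm. -/
def weightedNorm (x : ℤ → ℝ) : ℝ := ∑' n : ℤ, weightedTerm x n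

/-- The space `𝒳` of sequences with finite weighted norm. -/
def X : Set (ℤ → ℝ) := {x | Summable (weightedTerm x)}

/-- Sequences of `𝒳` with spacings between `M` and `N`. -/
def XMN (M N : ℤ) : Set (ℤ → ℝ) :=
  {x | x ∈ X ∧ ∀ n : ℤ, (M : ℝ) ≤ x (n + 1) - x n ∧ x (n + 1) - x n ≤ N}

/-- `n⁻(m) = max {n | T_{mn} x ≤ x}`. -/
def nMinus (x : ℤ → ℝ) (m : ℤ) : ℤ := sSup {n : ℤ | translate m n x ≤ x}

/-- `n⁺(m) = min {n | T_{mn} x ≥ x}`. -/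
def nPlus (x : ℤ → ℝ) (m : ℤ) : ℤ := sInf {n : ℤ | x ≤ translate m n x}

/-- The width `sup_m (n⁺(m) - n⁻(m))`. -/
def width (x : ℤ → ℝ) : EReal := ⨆ m : ℤ, (((nPlus x m - nMinus x m : ℤ) : ℝ) : EReal)

/-- The space `𝒳_ω` of sequences for which `x_n - n ω` is bounded. -/
def Xω (ω : ℝ) : Set (ℤ → ℝ) := {x | x ∈ X ∧ ∃ C : ℝ, ∀ n : ℤ, |x n - n * ω| ≤ C}

/-- The set `𝒳_ω¹` of sequences of `𝒳_ω` of width at most one. (On `𝒳_ω` the maxima and minima in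
the definition of the width exist.) -/
def XωOne (ω : ℝ) : Set (ℤ → ℝ) := {x | x ∈ Xω ω ∧ width x ≤ 1}

/-! ### The depinning force -/

/-- Forward solutions `y(t)`, `t ≥ 0`, of the gradient flow which stay in some `𝒳_{MN}`; the spacing
bound makes the solution unique, also when `h` has unbounded second derivatives. For an
initial value in `𝒳_ω¹` there is exactly one such solution. -/
def IsForwardSolution (h : ℝ → ℝ → ℝ) (F : ℝ) (y : ℝ → ℤ → ℝ) : Prop :=
  (∀ t : ℝ, 0 ≤ t → ∀ n : ℤ,
    HasDerivWithinAt (fun s => y s n) (vectorField h F (y t) n) (Set.Ici 0) t) ∧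
  ∃ M N : ℤ, ∀ t : ℝ, 0 ≤ t → y t ∈ XMN M N

/-- `v` is the average velocity of `y`: the limit, as `m - k → ∞` and `t → +∞`, of
`1/(t(m-k)) ∫_0^t ∑_{n=k}^{m-1} ẏ_n(s) ds`. -/
def HasAverageVelocity (h : ℝ → ℝ → ℝ) (F : ℝ) (y : ℝ → ℤ → ℝ) (v : ℝ) : Prop :=
  Tendsto
    (fun a : (ℤ × ℤ) × ℝ =>
      1 / (a.2 * ((a.1.2 - a.1.1 : ℤ) : ℝ)) *
        ∫ s in (0 : ℝ)..a.2, ∑ n ∈ Finset.Ico a.1.1 a.1.2, vectorField h F (y s) n)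
    (comap (fun a : (ℤ × ℤ) × ℝ => a.1.2 - a.1.1) atTop ⊓
      comap (fun a : (ℤ × ℤ) × ℝ => a.2) atTop)
    (𝓝 v)

/-- `ν̄(ω, F) = v`: the common average velocity of all solutions starting in `𝒳_ω¹`. -/
def AverageVelocityEq (h : ℝ → ℝ → ℝ) (ω F v : ℝ) : Prop :=
  ∀ y : ℝ → ℤ → ℝ, IsForwardSolution h F y → y 0 ∈ XωOne ω → HasAverageVelocity h F y v

/-- The depinning force `F_d(ω) = sup {F ≥ 0 | ν̄(ω, F) = 0}`. -/
def depinningForce (h : ℝ → ℝ → ℝ) (ω : ℝ) : ℝ :=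
  sSup {F : ℝ | 0 ≤ F ∧ AverageVelocityEq h ω F 0}

/-- `F_d(r+)`, the (upper) limit of `F_d(ω)` as `ω` decreases to `r`. -/
def depinningForcePlus (h : ℝ → ℝ → ℝ) (r : ℝ) : ℝ :=
  limsup (depinningForce h) (𝓝[>] r)

/-! ### Invariant ordered circles -/

/-- Ordered circles: images of strictly increasing maps `τ : ℝ → 𝒳`, continuous for the weighted
norm, with `τ(s + 1) = τ(s) + 𝟏`. -/
def IsOrderedCircle (ℓ : Set (ℤ → ℝ)) : Prop :=
  ∃ τ : ℝ → ℤ → ℝ,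
    (∀ s, τ s ∈ X) ∧
    (∀ s, Tendsto (fun s' => weightedNorm (τ s' - τ s)) (𝓝 s) (𝓝 0)) ∧
    (∀ s₁ s₂, s₁ < s₂ → τ s₁ < τ s₂) ∧
    (∀ s, τ (s + 1) = τ s + 1) ∧
    Set.range τ = ℓ

/-- Translation-invariant ordered circles. -/
def IsTOC (ℓ : Set (ℤ → ℝ)) : Prop :=
  IsOrderedCircle ℓ ∧ ∀ q p : ℤ, translate q p '' ℓ = ℓ

/-- Solutions of the gradient flow for all times. -/
def IsSolution (h : ℝ → ℝ → ℝ) (F : ℝ) (y : ℝ → ℤ → ℝ) : Prop :=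
  ∀ (t : ℝ) (n : ℤ), HasDerivAt (fun s => y s n) (vectorField h F (y t) n) t

/-- Invariant ordered circles: the solution through each point of `ℓ` exists for all `t ∈ ℝ` and
stays in `ℓ`. (The elements of a translation-invariant ordered circle have uniformly bounded
spacings, so there is only one solution that stays in `ℓ`.) -/
def IsIOC (h : ℝ → ℝ → ℝ) (F : ℝ) (ℓ : Set (ℤ → ℝ)) : Prop :=
  IsTOC ℓ ∧ ∀ x ∈ ℓ, ∃ y : ℝ → ℤ → ℝ, y 0 = x ∧ IsSolution h F y ∧ ∀ t, y t ∈ ℓ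

/-- Invariant ordered circles of type `p/q+`. -/
def IsIOCPlus (h : ℝ → ℝ → ℝ) (F : ℝ) (p : ℤ) (q : ℕ) (ℓ : Set (ℤ → ℝ)) : Prop :=
  IsIOC h F ℓ ∧
    (∀ x ∈ ℓ, HasMeanSpacing x ((p : ℝ) / q) ∧ translate q p x ≤ x) ∧
    ∃ x ∈ ℓ, translate q p x ≠ x

/-- Equilibria of type `p/q+`, i.e. equilibrium advancing discommensurations: Birkhoff equilibria
`x⁻ < x < x⁺` with `x⁻, x⁺` of type `(p, q)`, left-asymptotic to `x⁻` and right-asymptotic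
to `x⁺`. -/
def IsEquilibriumPlus (h : ℝ → ℝ → ℝ) (F : ℝ) (p : ℤ) (q : ℕ) (x : ℤ → ℝ) : Prop :=
  IsBirkhoff x ∧ IsEquilibrium h F x ∧
    ∃ xm xp : ℤ → ℝ,
      (IsBirkhoff xm ∧ IsEquilibrium h F xm ∧ IsPeriodicType p q xm) ∧
      (IsBirkhoff xp ∧ IsEquilibrium h F xp ∧ IsPeriodicType p q xp) ∧
      xm < x ∧ x < xp ∧
      Tendsto (fun n : ℤ => |x n - xm n|) atBot (𝓝 0) ∧
      Tendsto (fun n : ℤ => |x n - xp n|) atTop (𝓝 0)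

/-! ### Truncated energies and their Morse index -/

/-- The configuration which equals `y` at the sites strictly between `l` and `m` and `x`
elsewhere. -/
def glue (x : ℤ → ℝ) (l m : ℤ) (y : ↥(Finset.Ioo l m) → ℝ) (i : ℤ) : ℝ :=
  if hi : i ∈ Finset.Ioo l m then y ⟨i, hi⟩ else x i

/-- The truncated energy with end points fixed at `x_l` and `x_m`:
`h_F(x_l, y_{l+1}) + ∑_{i=l+1}^{m-2} h_F(y_i, y_{i+1}) + h_F(y_{m-1}, x_m)`. -/
def truncatedEnergy (h : ℝ → ℝ → ℝ) (F : ℝ) (x : ℤ → ℝ) (l m : ℤ)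
    (y : ↥(Finset.Ioo l m) → ℝ) : ℝ :=
  ∑ i ∈ Finset.Ico l m, tilted h F (glue x l m y i) (glue x l m y (i + 1))

/-- The Hessian matrix of a function of finitely many real variables. -/
def hessian {ι : Type} [Fintype ι] [DecidableEq ι] (W : (ι → ℝ) → ℝ) (y : ι → ℝ) :
    Matrix ι ι ℝ :=
  Matrix.of fun i j =>
    fderiv ℝ (fun z => fderiv ℝ W z (Pi.single j (1 : ℝ))) y (Pi.single i (1 : ℝ))

/-- `x` has positive Morse index from `l` to `m`: the matrix `-D²W_{l,m}` at
`(x_{l+1}, …, x_{m-1})` has a positive eigenvalue. -/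
def HasPositiveMorseIndex (h : ℝ → ℝ → ℝ) (F : ℝ) (x : ℤ → ℝ) (l m : ℤ) : Prop :=
  ∃ μ : ℝ, 0 < μ ∧
    Module.End.HasEigenvalue
      (Matrix.toLin' (-hessian (truncatedEnergy h F x l m) (fun i => x i))) μ

end FK

end

namespace FK

/-! ### Partial derivatives of the energy -/

/-! The argument is by contact with a barrier. The twist condition makes the field cooperative
(`IsEnergy.vectorField_le`), so `-D²W` has nonnegative off-diagonal entries. As in Perron-Frobenius,
an eigenvector for a positive eigenvalue may be replaced by its absolute value `v`: on its support,
`-D²W v` is at least the eigenvalue times `v`, hence positive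
(`HasPositiveMorseIndex.exists_direction`). Lowering the equilibrium `x` to `x - εv` between `l` and
`m` therefore makes the field negative on the support of `v` for all small `ε > 0`.

The circle supplies configurations `z < x` close to `x`, and by the strong maximum principle
(`IsEnergy.eq_of_vectorField_le`) such a `z` lies below `x` at every site. Increase `ε` until `x -
εv` first touches `z`. The contact site is in the support of `v`, and cooperativity gives `z` a
negative field there, contrary to the sign assumed along the circle. -/

theorem IsEnergy.hasFDerivAt {h : ℝ → ℝ → ℝ} (hh : IsEnergy h) (a b : ℝ) :
    HasFDerivAt (Function.uncurry h) (fderiv ℝ (Function.uncurry h) (a, b)) (a, b) :=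
  (hh.contDiff.differentiable (by norm_num) (a, b)).hasFDerivAt

theorem IsEnergy.d1_eq {h : ℝ → ℝ → ℝ} (hh : IsEnergy h) (a b : ℝ) :
    d1 h a b = fderiv ℝ (Function.uncurry h) (a, b) (1, 0) := by
  have hc : HasDerivAt (fun u : ℝ => (u, b)) ((1, 0) : ℝ × ℝ) a :=
    (hasDerivAt_id a).prodMk (hasDerivAt_const a b)
  exact ((hh.hasFDerivAt a b).comp_hasDerivAt a hc).deriv

theorem IsEnergy.d2_eq {h : ℝ → ℝ → ℝ} (hh : IsEnergy h) (a b : ℝ) :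
    d2 h a b = fderiv ℝ (Function.uncurry h) (a, b) (0, 1) := by
  have hc : HasDerivAt (fun v : ℝ => (a, v)) ((0, 1) : ℝ × ℝ) b :=
    (hasDerivAt_const b a).prodMk (hasDerivAt_id b)
  exact ((hh.hasFDerivAt a b).comp_hasDerivAt b hc).deriv

theorem IsEnergy.hasFDerivAt_fderiv {h : ℝ → ℝ → ℝ} (hh : IsEnergy h) (a : ℝ × ℝ) :
    HasFDerivAt (fderiv ℝ (Function.uncurry h))
      (fderiv ℝ (fderiv ℝ (Function.uncurry h)) a) a :=
  ((hh.contDiff.fderiv_right (m := 1) (by norm_num)).differentiable (by norm_num) a).hasFDerivAt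

theorem IsEnergy.differentiable_d1 {h : ℝ → ℝ → ℝ} (hh : IsEnergy h) :
    Differentiable ℝ (fun a : ℝ × ℝ => d1 h a.1 a.2) := by
  simp only [hh.d1_eq]
  exact fun a => (hh.hasFDerivAt_fderiv a).differentiableAt.clm_apply (differentiableAt_const _)

theorem IsEnergy.differentiable_d2 {h : ℝ → ℝ → ℝ} (hh : IsEnergy h) :
    Differentiable ℝ (fun a : ℝ × ℝ => d2 h a.1 a.2) := by
  simp only [hh.d2_eq]
  exact fun a => (hh.hasFDerivAt_fderiv a).differentiableAt.clm_apply (differentiableAt_const _)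

theorem IsEnergy.deriv_fderiv_comp {h : ℝ → ℝ → ℝ} (hh : IsEnergy h) {γ : ℝ → ℝ × ℝ}
    {v : ℝ × ℝ} {s : ℝ} (hγ : HasDerivAt γ v s) (w : ℝ × ℝ) :
    deriv (fun t => fderiv ℝ (Function.uncurry h) (γ t) w) s =
      fderiv ℝ (fderiv ℝ (Function.uncurry h)) (γ s) v w := by
  have := ((hh.hasFDerivAt_fderiv (γ s)).comp_hasDerivAt s hγ).clm_apply (hasDerivAt_const s w)
  simpa using this.deriv

/-- Symmetry of second derivatives carries the twist bound over to `d2`, so both neighbours of a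
site act on it with the same sign. -/
theorem IsEnergy.deriv_d2 {h : ℝ → ℝ → ℝ} (hh : IsEnergy h) (a b : ℝ) :
    deriv (fun u => d2 h u b) a = d12 h a b := by
  have h1 := hh.deriv_fderiv_comp ((hasDerivAt_id' a).prodMk (hasDerivAt_const a b)) (0, 1)
  have h2 := hh.deriv_fderiv_comp ((hasDerivAt_const b a).prodMk (hasDerivAt_id' b)) (1, 0)
  have hsymm : IsSymmSndFDerivAt ℝ (Function.uncurry h) (a, b) :=
    hh.contDiff.contDiffAt.isSymmSndFDerivAt (by simp)
  simp only [d12, hh.d1_eq, hh.d2_eq]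
  rw [h1, h2]
  exact hsymm.eq _ _

theorem IsEnergy.d12_neg {h : ℝ → ℝ → ℝ} (hh : IsEnergy h) (a b : ℝ) : d12 h a b < 0 := by
  obtain ⟨c, hc, hd⟩ := hh.twist
  linarith [hd a b]

theorem IsEnergy.strictAnti_d1 {h : ℝ → ℝ → ℝ} (hh : IsEnergy h) (a : ℝ) :
    StrictAnti (fun v => d1 h a v) :=
  strictAnti_of_deriv_neg fun b => hh.d12_neg a b

theorem IsEnergy.strictAnti_d2 {h : ℝ → ℝ → ℝ} (hh : IsEnergy h) (b : ℝ) :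
    StrictAnti (fun u => d2 h u b) :=
  strictAnti_of_deriv_neg fun a => (hh.deriv_d2 a b).trans_lt (hh.d12_neg a b)

/-! ### Cooperativity of the gradient vector field -/

/-- The neighbours of a site enter only through `-d2` and `-d1`, which increase in the neighbour's
position by the twist. -/
theorem IsEnergy.vectorField_le {h : ℝ → ℝ → ℝ} (hh : IsEnergy h) (F : ℝ) {x y : ℤ → ℝ}
    (hxy : x ≤ y) {n : ℤ} (hn : x n = y n) : vectorField h F x n ≤ vectorField h F y n := by
  have h1 := (hh.strictAnti_d1 (y n)).antitone (hxy (n + 1))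
  have h2 := (hh.strictAnti_d2 (y n)).antitone (hxy (n - 1))
  simp only [vectorField, hn]
  linarith

/-- A strong maximum principle: at a contact site cooperativity and `hv` force equal fields, strict
monotonicity then forces contact at both neighbours, and contact spreads along the chain. -/
theorem IsEnergy.eq_of_vectorField_le {h : ℝ → ℝ → ℝ} (hh : IsEnergy h) {F : ℝ} {x y : ℤ → ℝ}
    (hxy : x ≤ y) (hv : ∀ n, vectorField h F y n ≤ vectorField h F x n) {n : ℤ}
    (hn : x n = y n) : x = y := by
  have key : ∀ k, x k = y k → x (k - 1) = y (k - 1) ∧ x (k + 1) = y (k + 1) := by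
    intro k hk
    have h1 := (hh.strictAnti_d1 (y k)).antitone (hxy (k + 1))
    have h2 := (hh.strictAnti_d2 (y k)).antitone (hxy (k - 1))
    have h3 := hv k
    simp only [vectorField, hk] at h1 h2 h3
    constructor
    · exact (hh.strictAnti_d2 (y k)).injective (show d2 h _ _ = d2 h _ _ by linarith)
    · exact (hh.strictAnti_d1 (y k)).injective (show d1 h _ _ = d1 h _ _ by linarith)
  funext k
  induction k using Int.inductionOn' (b := n) with
  | zero => exact hn
  | succ k _ ih => exact (key k ih).2
  | pred k _ ih => exact (key k ih).1

theorem IsEquilibrium.vectorField_eq_zero {h : ℝ → ℝ → ℝ} {F : ℝ} {x : ℤ → ℝ}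
    (hx : IsEquilibrium h F x) (n : ℤ) : vectorField h F x n = 0 := by
  have := hx n
  simp only [vectorField]
  linarith

/-! ### Derivatives of the truncated energy -/

/-- The derivative of the `i`-th coordinate of `glue`. -/
noncomputable def glueDeriv (l m i : ℤ) : (↥(Finset.Ioo l m) → ℝ) →L[ℝ] ℝ :=
  if hi : i ∈ Finset.Ioo l m then ContinuousLinearMap.proj ⟨i, hi⟩ else 0

theorem hasFDerivAt_glue (x : ℤ → ℝ) (l m i : ℤ) (y : ↥(Finset.Ioo l m) → ℝ) :
    HasFDerivAt (fun z => glue x l m z i) (glueDeriv l m i) y := by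
  by_cases hi : i ∈ Finset.Ioo l m
  · simp only [glue, glueDeriv, dif_pos hi]
    exact (ContinuousLinearMap.proj (R := ℝ) (φ := fun _ : ↥(Finset.Ioo l m) => ℝ)
      ⟨i, hi⟩).hasFDerivAt
  · simp only [glue, glueDeriv, dif_neg hi]
    exact hasFDerivAt_const _ _

theorem contDiff_glue (x : ℤ → ℝ) (l m i : ℤ) :
    ContDiff ℝ 2 (fun z => glue x l m z i) := by
  by_cases hi : i ∈ Finset.Ioo l m
  · simp only [glue, dif_pos hi]
    exact contDiff_apply ℝ ℝ _
  · simp only [glue, dif_neg hi]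
    exact contDiff_const

theorem glueDeriv_single (l m i : ℤ) (j : ↥(Finset.Ioo l m)) :
    glueDeriv l m i (Pi.single j (1 : ℝ)) = if i = j then 1 else 0 := by
  by_cases hi : i ∈ Finset.Ioo l m
  · simp only [glueDeriv, dif_pos hi, ContinuousLinearMap.proj_apply, Pi.single_apply,
      Subtype.ext_iff]
  · rw [if_neg (by rintro rfl; exact hi j.2)]
    simp only [glueDeriv, dif_neg hi, zero_apply]

theorem glue_self (x : ℤ → ℝ) (l m : ℤ) : glue x l m (fun i => x i) = x := by
  funext i
  simp [glue]

theorem IsEnergy.contDiff_truncatedEnergy {h : ℝ → ℝ → ℝ} (hh : IsEnergy h) (F : ℝ)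
    (x : ℤ → ℝ) (l m : ℤ) : ContDiff ℝ 2 (truncatedEnergy h F x l m) := by
  refine ContDiff.sum fun i _ => ?_
  exact (hh.contDiff.comp ((contDiff_glue x l m i).prodMk (contDiff_glue x l m (i + 1)))).sub
    (contDiff_const.mul (contDiff_glue x l m i))

theorem IsEnergy.fderiv_truncatedEnergy {h : ℝ → ℝ → ℝ} (hh : IsEnergy h) (F : ℝ)
    (x : ℤ → ℝ) (l m : ℤ) (y : ↥(Finset.Ioo l m) → ℝ) (j : ↥(Finset.Ioo l m)) :
    fderiv ℝ (truncatedEnergy h F x l m) y (Pi.single j (1 : ℝ)) =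
      -vectorField h F (glue x l m y) j := by
  set g := glue x l m y with hg
  have hterm : ∀ i : ℤ, HasFDerivAt
      (fun z => tilted h F (glue x l m z i) (glue x l m z (i + 1)))
      ((fderiv ℝ (Function.uncurry h) (g i, g (i + 1))).comp
        ((glueDeriv l m i).prod (glueDeriv l m (i + 1))) - F • glueDeriv l m i) y := by
    intro i
    have hc : HasFDerivAt (fun z => (glue x l m z i, glue x l m z (i + 1)))
        ((glueDeriv l m i).prod (glueDeriv l m (i + 1))) y :=
      (hasFDerivAt_glue x l m i y).prodMk (hasFDerivAt_glue x l m (i + 1) y)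
    exact ((hh.hasFDerivAt (g i) (g (i + 1))).comp y hc).sub
      ((hasFDerivAt_glue x l m i y).const_mul F)
  have hsum := HasFDerivAt.fun_sum (u := Finset.Ico l m) fun i _ => hterm i
  have hval : ∀ i : ℤ, ((fderiv ℝ (Function.uncurry h) (g i, g (i + 1))).comp
        ((glueDeriv l m i).prod (glueDeriv l m (i + 1))) - F • glueDeriv l m i)
        (Pi.single j (1 : ℝ)) =
      (if i = j then d1 h (g i) (g (i + 1)) - F else 0) +
        (if i = (j : ℤ) - 1 then d2 h (g i) (g (i + 1)) else 0) := by
    intro i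
    have hs : ∀ a b : ℝ, fderiv ℝ (Function.uncurry h) (g i, g (i + 1)) (a, b) =
        a * d1 h (g i) (g (i + 1)) + b * d2 h (g i) (g (i + 1)) := by
      intro a b
      have hab : ((a, b) : ℝ × ℝ) = a • ((1, 0) : ℝ × ℝ) + b • ((0, 1) : ℝ × ℝ) := by simp
      rw [hab, map_add, map_smul, map_smul, ← hh.d1_eq, ← hh.d2_eq, smul_eq_mul, smul_eq_mul]
    have e : (i + 1 = (j : ℤ)) ↔ i = (j : ℤ) - 1 := by omega
    simp only [sub_apply, ContinuousLinearMap.comp_apply,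
      ContinuousLinearMap.prod_apply, smul_apply, glueDeriv_single, hs, e,
      smul_eq_mul]
    split_ifs <;> ring
  have hj := Finset.mem_Ioo.1 j.2
  change fderiv ℝ (fun z => ∑ i ∈ Finset.Ico l m,
    tilted h F (glue x l m z i) (glue x l m z (i + 1))) y (Pi.single j (1 : ℝ)) = _
  rw [hsum.fderiv, sum_apply]
  simp only [hval]
  -- Site `j` belongs only to the bonds starting at `j - 1` and `j`; both lie in `Ico l m` because
  -- `l < j < m`.
  rw [Finset.sum_add_distrib, Finset.sum_ite_eq', Finset.sum_ite_eq',
    if_pos (Finset.mem_Ico.2 ⟨hj.1.le, hj.2⟩), if_pos (Finset.mem_Ico.2 ⟨by omega, by omega⟩),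
    sub_add_cancel]
  simp only [vectorField]
  ring

theorem IsEnergy.differentiable_vectorField_glue {h : ℝ → ℝ → ℝ} (hh : IsEnergy h) (F : ℝ)
    (x : ℤ → ℝ) (l m n : ℤ) :
    Differentiable ℝ (fun y => vectorField h F (glue x l m y) n) := by
  have hg : ∀ i, Differentiable ℝ (fun y => glue x l m y i) := fun i y =>
    (hasFDerivAt_glue x l m i y).differentiableAt
  exact ((hh.differentiable_d2.comp ((hg (n - 1)).prodMk (hg n))).neg.sub
    (hh.differentiable_d1.comp ((hg n).prodMk (hg (n + 1))))).add_const F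

theorem IsEnergy.hessian_eq {h : ℝ → ℝ → ℝ} (hh : IsEnergy h) (F : ℝ) (x : ℤ → ℝ) (l m : ℤ)
    (y : ↥(Finset.Ioo l m) → ℝ) (i j : ↥(Finset.Ioo l m)) :
    hessian (truncatedEnergy h F x l m) y i j =
      -fderiv ℝ (fun z => vectorField h F (glue x l m z) j) y (Pi.single i (1 : ℝ)) := by
  simp only [hessian, Matrix.of_apply, hh.fderiv_truncatedEnergy, fderiv_fun_neg,
    neg_apply]

theorem hessian_symm {ι : Type} [Fintype ι] [DecidableEq ι] {W : (ι → ℝ) → ℝ}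
    (hW : ContDiff ℝ 2 W) (y : ι → ℝ) (i j : ι) : hessian W y i j = hessian W y j i := by
  have hd : HasFDerivAt (fderiv ℝ W) (fderiv ℝ (fderiv ℝ W) y) y :=
    ((hW.fderiv_right (m := 1) (by norm_num)).differentiable (by norm_num) y).hasFDerivAt
  have happ : ∀ i j : ι, hessian W y i j =
      fderiv ℝ (fderiv ℝ W) y (Pi.single i (1 : ℝ)) (Pi.single j (1 : ℝ)) := by
    intro i j
    simp only [hessian, Matrix.of_apply]
    rw [fderiv_clm_apply hd.differentiableAt (differentiableAt_const _)]
    simp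
  rw [happ, happ]
  exact hW.contDiffAt.isSymmSndFDerivAt (by simp) _ _

/-- Raising site `j` leaves site `i ≠ j` fixed, so by cooperativity the field at `i` is monotone
along this line; no formula for the second derivatives is needed. -/
theorem IsEnergy.fderiv_vectorField_glue_nonneg {h : ℝ → ℝ → ℝ} (hh : IsEnergy h) (F : ℝ)
    (x : ℤ → ℝ) (l m : ℤ) (y : ↥(Finset.Ioo l m) → ℝ) {i j : ↥(Finset.Ioo l m)} (hij : i ≠ j) :
    0 ≤ fderiv ℝ (fun z => vectorField h F (glue x l m z) i) y (Pi.single j (1 : ℝ)) := by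
  have hc : HasDerivAt (fun t : ℝ => y + t • (Pi.single j (1 : ℝ) : ↥(Finset.Ioo l m) → ℝ))
      (Pi.single j (1 : ℝ)) 0 := by
    simpa using ((hasDerivAt_id (0 : ℝ)).smul_const
      (Pi.single j (1 : ℝ) : ↥(Finset.Ioo l m) → ℝ)).const_add y
  have hd := (hh.differentiable_vectorField_glue F x l m i
    (y + (0 : ℝ) • Pi.single j (1 : ℝ))).hasFDerivAt.comp_hasDerivAt (0 : ℝ) hc
  rw [zero_smul, add_zero] at hd
  rw [← hd.deriv]
  refine Monotone.deriv_nonneg fun s t hst => hh.vectorField_le F (fun k => ?_) ?_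
  · unfold glue
    split_ifs with hk
    · simp only [Pi.add_apply, Pi.smul_apply, Pi.single_apply, smul_eq_mul]
      split_ifs <;> linarith
    · exact le_rfl
  · simp [glue, hij]

/-- A linear functional with nonnegative coefficients off `i` does not decrease, up to the sign of
`u i`, when `u` is replaced by `|u|`. -/
theorem mul_abs_le_apply_abs {ι : Type*} [Fintype ι] [DecidableEq ι] (A : (ι → ℝ) →L[ℝ] ℝ)
    {i : ι} (hA : ∀ j, i ≠ j → 0 ≤ A (Pi.single j 1)) {μ : ℝ} {u : ι → ℝ} (hu : A u = μ * u i) :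
    μ * |u i| ≤ A (fun j => |u j|) := by
  have hsum : ∀ w : ι → ℝ, A w = ∑ j, w j * A (Pi.single j 1) := by
    intro w
    conv_lhs => rw [pi_eq_sum_univ' w, map_sum]
    simp [smul_eq_mul]
  -- `σ` is a sign of `u i`. The diagonal coefficient may have either sign, but there `σ * u i = |u
  -- i|` is an equality.
  obtain ⟨σ, hσ, hσ'⟩ : ∃ σ : ℝ, σ * u i = |u i| ∧ ∀ a : ℝ, σ * a ≤ |a| := by
    rcases abs_choice (u i) with hi | hi
    · exact ⟨1, by rw [hi, one_mul], fun a => by rw [one_mul]; exact le_abs_self a⟩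
    · exact ⟨-1, by rw [hi]; ring, fun a => by rw [neg_one_mul]; exact neg_le_abs a⟩
  have h1 : μ * |u i| = σ * A u := by rw [hu, ← hσ]; ring
  rw [h1, hsum u, hsum (fun j => |u j|), Finset.mul_sum]
  refine Finset.sum_le_sum fun j _ => ?_
  rw [← mul_assoc]
  by_cases hij : i = j
  · subst hij
    rw [hσ]
  · exact mul_le_mul_of_nonneg_right (hσ' _) (hA j hij)

/-- If the Morse index is positive, there is a nonnegative direction, not identically zero, which
the linearized flow expands at every site of its support. -/
theorem HasPositiveMorseIndex.exists_direction {h : ℝ → ℝ → ℝ} (hh : IsEnergy h) {F : ℝ}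
    {x : ℤ → ℝ} {l m : ℤ} (hx : HasPositiveMorseIndex h F x l m) :
    ∃ v : ↥(Finset.Ioo l m) → ℝ, (∀ i, 0 ≤ v i) ∧ (∃ i, 0 < v i) ∧ ∀ i, 0 < v i →
      0 < fderiv ℝ (fun z => vectorField h F (glue x l m z) i) (fun i => x i) v := by
  obtain ⟨μ, hμ, hev⟩ := hx
  obtain ⟨u, hu⟩ := hev.exists_hasEigenvector
  have hne := hu.2
  have heq := hu.apply_eq_smul
  rw [Matrix.toLin'_apply] at heq
  refine ⟨fun i => |u i|, fun i => abs_nonneg _, ?_, fun i hi => ?_⟩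
  · obtain ⟨i, hi⟩ := Function.ne_iff.1 hne
    exact ⟨i, abs_pos.2 hi⟩
  · refine (mul_pos hμ hi).trans_le (mul_abs_le_apply_abs _
      (fun j hij => hh.fderiv_vectorField_glue_nonneg F x l m _ hij) ?_)
    have hi' := congrFun heq i
    simp only [Matrix.mulVec, dotProduct, Matrix.neg_apply, Pi.smul_apply, smul_eq_mul] at hi'
    rw [← hi']
    conv_lhs => rw [pi_eq_sum_univ' u, map_sum]
    refine Finset.sum_congr rfl fun j _ => ?_
    -- `hessian_eq` has the field component as second index, whereas the matrix product needs it as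
    -- row index.
    rw [hessian_symm (hh.contDiff_truncatedEnergy F x l m), hh.hessian_eq, map_smul, neg_neg,
      smul_eq_mul, mul_comm]

/-! ### Ordered circles -/

theorem sub_mem_X {x y : ℤ → ℝ} (hx : x ∈ X) (hy : y ∈ X) : x - y ∈ X := by
  refine Summable.of_nonneg_of_le (fun n => by unfold weightedTerm; positivity) (fun n => ?_)
    (Summable.add hx hy)
  simp only [weightedTerm, Pi.sub_apply, ← mul_add]
  exact mul_le_mul_of_nonneg_left (abs_sub _ _) (by positivity)

theorem weightedTerm_le_weightedNorm {x : ℤ → ℝ} (hx : x ∈ X) (n : ℤ) :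
    weightedTerm x n ≤ weightedNorm x :=
  Summable.le_tsum hx n fun k _ => by unfold weightedTerm; positivity

theorem tendsto_apply_of_tendsto_weightedNorm {α : Type*} {f : Filter α} {y : α → ℤ → ℝ}
    {x : ℤ → ℝ} (hy : ∀ a, y a ∈ X) (hx : x ∈ X)
    (ht : Tendsto (fun a => weightedNorm (y a - x)) f (𝓝 0)) (n : ℤ) :
    Tendsto (fun a => y a n) f (𝓝 (x n)) := by
  have hw : Tendsto (fun a => weightedTerm (y a - x) n) f (𝓝 0) :=
    squeeze_zero (fun a => by unfold weightedTerm; positivity)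
      (fun a => weightedTerm_le_weightedNorm (sub_mem_X (hy a) hx) n) ht
  -- Undoes the weight of site `n`.
  have h2 := hw.const_mul (2 ^ n.natAbs : ℝ)
  rw [mul_zero] at h2
  rw [tendsto_iff_norm_sub_tendsto_zero]
  refine h2.congr fun a => ?_
  rw [weightedTerm, ← mul_assoc, ← mul_pow]
  norm_num

/-- Along an ordered circle, points are approached pointwise by strictly smaller ones. -/
theorem IsOrderedCircle.exists_lt {ℓ : Set (ℤ → ℝ)} (hℓ : IsOrderedCircle ℓ) {x : ℤ → ℝ}
    (hx : x ∈ ℓ) (n : ℤ) {ε : ℝ} (hε : 0 < ε) : ∃ z ∈ ℓ, z < x ∧ x n - ε < z n := by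
  obtain ⟨τ, hX, hcont, hmono, -, rfl⟩ := hℓ
  obtain ⟨s, rfl⟩ := hx
  -- Restricting to parameters below `s` makes the approximating points strictly smaller.
  have ht := (tendsto_apply_of_tendsto_weightedNorm hX (hX s) (hcont s) n).mono_left
    (nhdsWithin_le_nhds (s := Set.Iio s))
  obtain ⟨s', h1, h2⟩ := ((ht.eventually (lt_mem_nhds (sub_lt_self _ hε))).and
    self_mem_nhdsWithin).exists
  exact ⟨τ s', ⟨s', rfl⟩, hmono _ _ h2, h1⟩

/-- An equilibrium on an ordered circle along which the vector field is nonnegative has no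
positive Morse index. -/
theorem IsOrderedCircle.not_hasPositiveMorseIndex {h : ℝ → ℝ → ℝ} (hh : IsEnergy h) {F : ℝ}
    {ℓ : Set (ℤ → ℝ)} (hℓ : IsOrderedCircle ℓ) (hpos : ∀ z ∈ ℓ, ∀ n, 0 ≤ vectorField h F z n)
    {x : ℤ → ℝ} (hx : x ∈ ℓ) (heq : IsEquilibrium h F x) (l m : ℤ) :
    ¬ HasPositiveMorseIndex h F x l m := by
  intro hM
  obtain ⟨v, hv0, ⟨k, hk⟩, hv⟩ := hM.exists_direction hh
  set w : ℝ → ℤ → ℝ := fun ε => glue x l m ((fun i : ↥(Finset.Ioo l m) => x i) + (-ε) • v) with hw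
  -- At `ε = 0` the field vanishes and its derivative along `-v` is negative at each support site;
  -- finitely many sites allow a common range of `ε`.
  have hneg : ∀ᶠ ε in 𝓝[>] (0 : ℝ), ∀ i, 0 < v i → vectorField h F (w ε) i < 0 := by
    refine eventually_all.2 fun i => ?_
    by_cases hi : 0 < v i
    swap
    · exact Eventually.of_forall fun ε h => absurd h hi
    have hc : HasDerivAt (fun ε : ℝ => (fun i : ↥(Finset.Ioo l m) => x i) + (-ε) • v) (-v) 0 := by
      simpa using ((hasDerivAt_id (0 : ℝ)).neg.smul_const v).const_add
        (fun i : ↥(Finset.Ioo l m) => x i)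
    have hd := (hh.differentiable_vectorField_glue F x l m i
      ((fun i : ↥(Finset.Ioo l m) => x i) + (-(0 : ℝ)) • v)).hasFDerivAt.comp_hasDerivAt (0 : ℝ) hc
    rw [neg_zero, zero_smul, add_zero, map_neg] at hd
    have hlim := (hasDerivAt_iff_tendsto_slope.1 hd).mono_left
      (nhdsWithin_mono (0 : ℝ) fun a (ha : 0 < a) => ha.ne')
    filter_upwards [hlim.eventually (gt_mem_nhds (neg_lt_zero.2 (hv i hi))),
      self_mem_nhdsWithin] with ε hε (hε0 : 0 < ε) _
    have h0 : vectorField h F (glue x l m ((fun i : ↥(Finset.Ioo l m) => x i) + (-(0 : ℝ)) • v)) i = 0 := by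
      rw [neg_zero, zero_smul, add_zero, glue_self]
      exact heq.vectorField_eq_zero i
    rw [slope_def_field] at hε
    simp only [Function.comp_apply, h0, sub_zero] at hε
    exact (div_neg_iff.1 hε).elim (fun h => absurd h.2 hε0.not_gt) fun h => h.1
  obtain ⟨ε₀, hε₀, hneg⟩ := mem_nhdsGT_iff_exists_Ioo_subset.1 hneg
  -- Closeness at the single support site `k` suffices: the ratio at `k` bounds the minimal ratio
  -- chosen below.
  obtain ⟨z, hz, hzx, hzk⟩ := hℓ.exists_lt hx k (mul_pos hε₀ hk)
  have hlt : ∀ n, z n < x n := fun n => (hzx.le n).lt_of_ne fun hn => hzx.ne <|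
    hh.eq_of_vectorField_le hzx.le (F := F)
      (fun j => (heq.vectorField_eq_zero j).trans_le (hpos z hz j)) hn
  -- The minimal ratio is the largest `ε` with `z ≤ w ε`, and it is attained by contact at `n`.
  obtain ⟨n, hn, hmin⟩ := (Finset.univ.filter fun i => 0 < v i).exists_min_image
    (fun i => (x i - z i) / v i) ⟨k, by simpa using hk⟩
  simp only [Finset.mem_filter, Finset.mem_univ, true_and] at hn hmin
  set ε := (x n - z n) / v n with hε
  have hεpos : 0 < ε := div_pos (sub_pos.2 (hlt n)) hn
  have hεlt : ε < ε₀ := (hmin k hk).trans_lt ((div_lt_iff₀ hk).2 (by linarith))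
  have hzw : z ≤ w ε := by
    intro i
    simp only [hw, glue]
    split_ifs with hi
    · simp only [Pi.add_apply, Pi.smul_apply, smul_eq_mul]
      rcases (hv0 ⟨i, hi⟩).eq_or_lt with h0 | h0
      · rw [← h0]
        simpa using hzx.le i
      · have := (le_div_iff₀ h0).1 (hmin ⟨i, hi⟩ h0)
        simp only at this
        linarith
    · exact hzx.le i
  have hzn : z n = w ε n := by
    have : ε * v n = x n - z n := div_mul_cancel₀ _ hn.ne'
    simp only [hw, glue, dif_pos n.2, Pi.add_apply, Pi.smul_apply, smul_eq_mul, Subtype.coe_eta]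
    linarith
  exact absurd ((hpos z hz n).trans (hh.vectorField_le F hzw hzn))
    (hneg ⟨hεpos, hεlt⟩ n hn).not_ge

end FK

theorem mainTheorem8 (h : ℝ → ℝ → ℝ) (hh : FK.IsEnergy h)
    (p : ℤ) (q : ℕ) (hq : 0 < q) (hpq : IsCoprime p (q : ℤ))
    (F : ℝ)
    (hF₁ : FK.depinningForcePlus h ((p : ℝ) / q) ≤ F)
    (hF₂ : F < FK.depinningForce h ((p : ℝ) / q))
    (ℓ : Set (ℤ → ℝ)) (hℓ : FK.IsIOCPlus h F p q ℓ)
    (hpos : ∀ z ∈ ℓ, ∀ n : ℤ, 0 ≤ FK.vectorField h F z n) :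
    ∀ x ∈ ℓ, FK.IsEquilibriumPlus h F p q x →
      ∀ l m : ℤ, l < m - 1 → ¬ FK.HasPositiveMorseIndex h F x l m := by
  intro x hx hxe l m _
  exact hℓ.1.1.1.not_hasPositiveMorseIndex hh hpos hx hxe.2.1 l m
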